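/- All circuits are Boolean circuits over $\vee,\wedge,\neg$ (directed acyclic, possibly non-uniform families). A family $\{C_n\}_{n>0}$ is a proof system for a language $L\subseteq\{0,1\}^*$ if there is a function $m:\mathbb N\to\mathbb N$ such that, for each $n>0$ with $L^{=n}:=L\cap\{0,1\}^n\neq\emptyset$, the circuit $C_n$ has $m(n)$ inputs and $n$ outputs and $\{C_n(x) : x\in\{0,1\}^{m(n)}\}=L^{=n}$. It is an $\mathrm{SAC}^0$ proof system if moreover its size (number of inputs plus number of gates) is bounded by a polynomial in $n$, it has depth $O(1)$, negations appear only at the leaves (that is, are applied only to input bits), $\vee$ gates have unbounded fan-in, and $\wedge$ gates have fan-in $O(1)$. It is a $\mathrm{coSAC}^0$ proof system if the same holds with the roles of $\vee$ and $\wedge$ exchanged ($\wedge$ gates of unbounded fan-in, $\vee$ gates of fan-in $O(1)$). **Theorem.** Let $L\subseteq\{0,1\}^*$ be any language in $\mathrm{NP}$. 1. If $0^*\subseteq L$, then $L$ has a $\mathrm{coSAC}^0$ proof system. 2. If $1^*\subseteq L$, then $L$ has an $\mathrm{SAC}^0$ proof system. 3. The language $(\{1\}\cdot L\cdot\{0\})\cup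 0^*\cup 1^*$ has both an $\mathrm{SAC}^0$ proof system and a $\mathrm{coSAC}^0$ proof system. -/

import Mathlib

open scoped Computability

namespace ProofCircuit

/-- The type of a gate of a circuit with `m` input bits whose gates are named by elements of `V`.
An `∧` or `∨` gate has an arbitrary finite set of predecessors (the empty `∧` is the constant `1`
and the empty `∨` the constant `0`). -/
inductive Op (m : ℕ) (V : Type) : Type
  | input (i : Fin m) : Op m V
  | not (u : V) : Op m V
  | and (s : Finset V) : Op m V
  | or (s : Finset V) : Op m V

/-- The set of predecessors of a gate; its cardinality is the fan-in. -/
def Op.preds {m : ℕ} {V : Type} : Op m V → Finset V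
  | .input _ => ∅
  | .not u => {u}
  | .and s => s
  | .or s => s

/-- A Boolean circuit over `∨, ∧, ¬` with `m` inputs and `n` outputs: a finite set of gates,
with an acyclic predecessor relation, and a gate for each of the `n` output bits. -/
structure Circuit (m n : ℕ) where
  /-- the gates (the input nodes included) -/
  V : Type
  /-- there are finitely many gates -/
  fin : Fintype V
  /-- the label and the predecessors of each gate -/
  op : V → Op m V
  /-- the predecessor relation has no cycle -/
  acyclic : WellFounded (fun u v : V => u ∈ (op v).preds)
  /-- the gates that compute the output bits -/
  output : Fin n → V

namespace Circuit

variable {m n : ℕ}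

open Classical in
/-- The value of a gate from the values of its predecessors. -/
noncomputable def opValue {V : Type} (x : Fin m → Bool) : (o : Op m V) → ((u : V) → u ∈ o.preds → Bool) → Bool
  | .input i, _ => x i
  | .not u, val => !(val u (Finset.mem_singleton_self u))
  | .and s, val => decide (∀ u, ∀ h : u ∈ s, val u h = true)
  | .or s, val => decide (∃ u, ∃ h : u ∈ s, val u h = true)

/-- The value computed at the gate `v` on the input `x`. -/
noncomputable def value (C : Circuit m n) (x : Fin m → Bool) : C.V → Bool :=
  C.acyclic.fix fun v val => opValue x (C.op v) val

theorem value_eq (C : Circuit m n) (x : Fin m → Bool) (v : C.V) :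
    C.value x v = opValue x (C.op v) fun u _ => C.value x u := by
  unfold value
  rw [WellFounded.fix_eq]

/-- The function `{0,1}^m → {0,1}^n` computed by the circuit. -/
noncomputable def eval (C : Circuit m n) (x : Fin m → Bool) : Fin n → Bool :=
  fun j => C.value x (C.output j)

/-- The depth of a gate: the length of a longest path from a gate without predecessors to it. -/
noncomputable def gateDepth (C : Circuit m n) : C.V → ℕ :=
  C.acyclic.fix fun v d => (C.op v).preds.attach.sup fun u => d u.1 u.2 + 1

theorem gateDepth_eq (C : Circuit m n) (v : C.V) :
    C.gateDepth v = (C.op v).preds.sup fun u => C.gateDepth u + 1 := by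
  unfold gateDepth
  rw [WellFounded.fix_eq]
  exact Finset.sup_attach _ (fun u => WellFounded.fix C.acyclic _ u + 1)

/-- All gates have depth at most `d`. -/
def DepthLE (C : Circuit m n) (d : ℕ) : Prop :=
  ∀ v, C.gateDepth v ≤ d

/-- The size of a circuit: its number of input bits (used or not) plus its number of gates. -/
def size (C : Circuit m n) : ℕ :=
  m + @Fintype.card C.V C.fin

/-- Negations appear only at the leaf level: every negation is applied to an input bit. -/
def NegationsAtLeaves (C : Circuit m n) : Prop :=
  ∀ v u, C.op v = .not u → ∃ i, C.op u = .input i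

/-- All `∧` gates have fan-in at most `c`. -/
def AndFaninLE (C : Circuit m n) (c : ℕ) : Prop :=
  ∀ v s, C.op v = .and s → s.card ≤ c

/-- All `∨` gates have fan-in at most `c`. -/
def OrFaninLE (C : Circuit m n) (c : ℕ) : Prop :=
  ∀ v s, C.op v = .or s → s.card ≤ c

end Circuit

/-- The (possibly non-uniform) family of circuits `C n`, `n > 0`, where `C n` has `m n` inputs and
`n` outputs, is a proof system for `L`: for every `n > 0` for which `L` has a word of length `n`,
the range of the function computed by `C n` is the set of words of length `n` in `L`. -/
def IsProofSystem (L : Language Bool) (m : ℕ → ℕ) (C : (n : ℕ) → Circuit (m n) n) : Prop :=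
  ∀ n, 0 < n → (∃ y : Fin n → Bool, List.ofFn y ∈ L) →
    (∀ y : Fin n → Bool, List.ofFn y ∈ L → ∃ x : Fin (m n) → Bool, (C n).eval x = y) ∧
    (∀ x : Fin (m n) → Bool, List.ofFn ((C n).eval x) ∈ L)

/-- `SAC⁰` circuit families: polynomial size, constant depth, negations only at the leaves,
`∧` gates of constant fan-in, `∨` gates of unbounded fan-in. -/
def IsSAC0 (m : ℕ → ℕ) (C : (n : ℕ) → Circuit (m n) n) : Prop :=
  ∃ (p : Polynomial ℕ) (d c : ℕ), ∀ n, 0 < n →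
    (C n).size ≤ p.eval n ∧ (C n).DepthLE d ∧ (C n).NegationsAtLeaves ∧ (C n).AndFaninLE c

/-- `coSAC⁰` circuit families: polynomial size, constant depth, negations only at the leaves,
`∨` gates of constant fan-in, `∧` gates of unbounded fan-in. -/
def IsCoSAC0 (m : ℕ → ℕ) (C : (n : ℕ) → Circuit (m n) n) : Prop :=
  ∃ (p : Polynomial ℕ) (d c : ℕ), ∀ n, 0 < n →
    (C n).size ≤ p.eval n ∧ (C n).DepthLE d ∧ (C n).NegationsAtLeaves ∧ (C n).OrFaninLE c

/-- `L` has an `SAC⁰` proof system. -/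
def HasSAC0ProofSystem (L : Language Bool) : Prop :=
  ∃ (m : ℕ → ℕ) (C : (n : ℕ) → Circuit (m n) n), IsProofSystem L m C ∧ IsSAC0 m C

/-- `L` has a `coSAC⁰` proof system. -/
def HasCoSAC0ProofSystem (L : Language Bool) : Prop :=
  ∃ (m : ℕ → ℕ) (C : (n : ℕ) → Circuit (m n) n), IsProofSystem L m C ∧ IsCoSAC0 m C

/-- The pair `(x, y)` of binary words as a word over the alphabet `{0,1} ⊕ {0,1}`: the letters of
`x` in the first copy of the alphabet, followed by those of `y` in the second. -/
def encodePair : List Bool × List Bool → List (Bool ⊕ Bool) :=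
  (Computability.encodingProd (Computability.encodingList Bool)
    (Computability.encodingList Bool)).encode

/-- `L ∈ NP`: there are a polynomial `p` and a predicate `R` on pairs of words that is decided by a
deterministic Turing machine in polynomial time, such that `x ∈ L` if and only if `R (x, y)` holds
for some word `y` of length at most `p |x|`. -/
def InNP (L : Language Bool) : Prop :=
  ∃ (p : Polynomial ℕ) (R : List Bool × List Bool → Bool),
    Nonempty (Turing.TM2ComputableInPolyTime encodePair Computability.encodeBool R) ∧
    ∀ x : List Bool, x ∈ L ↔ ∃ y : List Bool, y.length ≤ p.eval x.length ∧ R (x, y) = true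

end ProofCircuit

namespace ProofCircuit

open Turing

/-! ### Local predicates on Boolean assignments -/

section Local

variable {V : Type*}

/-! By the Cook–Levin argument, the words of length `n` of an NP language are the projections to `n`
variables of the solutions of a CNF of constant width `k` on polynomially many variables, the cells
of a tableau (`InNP.hasLocalVerifier`). A proof is an assignment to these variables. The `j`-th
output bit is the conjunction of the `j`-th projected variable and all clauses. If the clauses hold,
the output is the projected word, which lies in `L`; otherwise it is `0^n`, which lies in `L` by
hypothesis. There are at most `(2|U| + 1)^k` clauses, each an `∨` of at most `k` literals, so the
circuit is of type `coSAC⁰` (`HasLocalVerifier.hasCoSAC0ProofSystem`).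

The case of `1*` follows by De Morgan duality applied to the bitwise complement of `L`. For the last
claim, selector variables extend the CNF of `L` to one for the enlarged language
(`HasLocalVerifier.true_mul_mul_false_add`), to which both constructions apply.

Width-`k` CNFs are handled semantically, through `IsLocalOn`: this notion is closed under arbitrary
conjunctions without increasing `k`, and the clauses are recovered by `IsLocalOn.iff_clauses`. -/

/-- A predicate on Boolean assignments is `k`-local on `U` if it holds of `a` as soon as the
restriction of `a` to every set of at most `k` variables from `U` extends to an assignment
satisfying it; equivalently, it is a conjunction of clauses of width `k` with variables in `U`. -/
def IsLocalOn (U : Finset V) (k : ℕ) (P : (V → Bool) → Prop) : Prop :=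
  ∀ a, (∀ S ⊆ U, S.card ≤ k → ∃ b, P b ∧ ∀ v ∈ S, a v = b v) → P a

theorem IsLocalOn.mono {U : Finset V} {k l : ℕ} {P : (V → Bool) → Prop} (h : IsLocalOn U k P)
    (hkl : k ≤ l) : IsLocalOn U l P :=
  fun a ha => h a fun S hS hc => ha S hS (hc.trans hkl)

theorem IsLocalOn.and {U : Finset V} {k : ℕ} {P Q : (V → Bool) → Prop} (hP : IsLocalOn U k P)
    (hQ : IsLocalOn U k Q) : IsLocalOn U k fun a => P a ∧ Q a := fun a ha =>
  ⟨hP a fun S hS hc => (ha S hS hc).imp fun _ hb => ⟨hb.1.1, hb.2⟩,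
    hQ a fun S hS hc => (ha S hS hc).imp fun _ hb => ⟨hb.1.2, hb.2⟩⟩

theorem IsLocalOn.forall {ι : Sort*} {U : Finset V} {k : ℕ} {P : ι → (V → Bool) → Prop}
    (hP : ∀ i, IsLocalOn U k (P i)) : IsLocalOn U k fun a => ∀ i, P i a := fun a ha i =>
  hP i a fun S hS hc => (ha S hS hc).imp fun _ hb => ⟨hb.1 i, hb.2⟩

theorem isLocalOn_of_agree {U S : Finset V} {k : ℕ} {P : (V → Bool) → Prop} (hS : S ⊆ U)
    (hc : S.card ≤ k) (h : ∀ a b, (∀ v ∈ S, a v = b v) → P b → P a) : IsLocalOn U k P :=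
  fun a ha => let ⟨b, hb, hab⟩ := ha S hS hc; h a b hab hb

theorem IsLocalOn.comp_not {U : Finset V} {k : ℕ} {P : (V → Bool) → Prop} (h : IsLocalOn U k P) :
    IsLocalOn U k fun a => P fun v => !a v := fun a ha =>
  h _ fun S hS hc =>
    let ⟨b, hb, hab⟩ := ha S hS hc
    ⟨_, hb, fun v hv => by rw [hab v hv]⟩

/-- The clause with literals `f j`; the literal `(v, b)` is true if `v` has the value `b`. -/
def ClauseHolds {k : ℕ} (f : Fin k → Option (V × Bool)) (a : V → Bool) : Prop :=
  ∃ j, ∃ l ∈ f j, a l.1 = l.2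

/-- A local predicate is the conjunction of the clauses of bounded width that it implies. -/
theorem IsLocalOn.iff_clauses {U : Finset V} {k : ℕ} {P : (V → Bool) → Prop}
    (h : IsLocalOn U k P) (a : V → Bool) :
    P a ↔ ∀ f : Fin k → Option (U × Bool),
      (∀ b, P b → ClauseHolds f fun u => b u) → ClauseHolds f fun u => a u := by
  refine ⟨fun ha f hf => hf a ha, fun ha => h a fun S hS hc => ?_⟩
  by_contra! hcon
  -- The clause says that some variable of `S` differs from its value under `a`. It is false at `a`,
  -- but `P` implies it because no solution agrees with `a` on `S`. Unused slots are padded with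
  -- `none`.
  have key := ha (fun j => if hj : j.1 < S.card then
    some (⟨(S.equivFin.symm ⟨j, hj⟩).1, hS (S.equivFin.symm ⟨j, hj⟩).2⟩,
      !a (S.equivFin.symm ⟨j, hj⟩).1) else none) ?_
  · obtain ⟨j, l, hl, hal⟩ := key
    beta_reduce at hl
    split_ifs at hl with hj
    · simp only [Option.mem_def, Option.some.injEq] at hl
      subst hl
      simp at hal
    · simp at hl
  · intro b hb
    obtain ⟨v, hv, hne⟩ := hcon b hb
    refine ⟨⟨S.equivFin ⟨v, hv⟩, (S.equivFin ⟨v, hv⟩).2.trans_le hc⟩, (⟨v, hS hv⟩, !a v), ?_, ?_⟩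
    · simp
    · revert hne
      change a v ≠ b v → b v = !a v
      cases a v <;> cases b v <;> simp

end Local

/-- For each `n`, the words of length `n` in `L` are the projections of the solutions of a local
predicate on polynomially many Boolean variables. -/
def HasLocalVerifier (L : Language Bool) : Prop :=
  ∃ (k : ℕ) (p : Polynomial ℕ), ∀ n, ∃ (V : Type) (U : Finset V) (P : (V → Bool) → Prop)
    (out : Fin n → V), U.card ≤ p.eval n ∧ IsLocalOn U k P ∧ (∀ i, out i ∈ U) ∧
      ∀ y : Fin n → Bool, List.ofFn y ∈ L ↔ ∃ a, P a ∧ ∀ i, a (out i) = y i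

/-! ### Gate values by type, and depth bounds from a rank function. -/

namespace Circuit

variable {m n : ℕ}

theorem value_of_input (C : Circuit m n) (x : Fin m → Bool) {v : C.V} {i : Fin m}
    (h : C.op v = .input i) : C.value x v = x i := by
  rw [value_eq, h]; rfl

theorem value_of_not (C : Circuit m n) (x : Fin m → Bool) {v u : C.V} (h : C.op v = .not u) :
    C.value x v = !C.value x u := by
  rw [value_eq, h]; rfl

theorem value_of_and (C : Circuit m n) (x : Fin m → Bool) {v : C.V} {s : Finset C.V}
    (h : C.op v = .and s) : C.value x v = true ↔ ∀ u ∈ s, C.value x u = true := by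
  rw [value_eq, h]; simp [opValue]

theorem value_of_or (C : Circuit m n) (x : Fin m → Bool) {v : C.V} {s : Finset C.V}
    (h : C.op v = .or s) : C.value x v = true ↔ ∃ u ∈ s, C.value x u = true := by
  rw [value_eq, h]; simp [opValue]

theorem gateDepth_le_of_rank (C : Circuit m n) (rank : C.V → ℕ)
    (h : ∀ v, ∀ u ∈ (C.op v).preds, rank u < rank v) (v : C.V) : C.gateDepth v ≤ rank v := by
  induction v using C.acyclic.induction with
  | _ v ih =>
    rw [gateDepth_eq]
    exact Finset.sup_le fun u hu => (Nat.succ_le_succ (ih u hu)).trans (h v u hu)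

end Circuit

/-! ### The dual circuit -/

/-- The dual of a gate: `∧` and `∨` are exchanged. -/
def Op.dual {m : ℕ} {V : Type} : Op m V → Op m V
  | .input i => .input i
  | .not u => .not u
  | .and s => .or s
  | .or s => .and s

theorem Op.preds_dual {m : ℕ} {V : Type} (o : Op m V) : o.dual.preds = o.preds := by
  cases o <;> rfl

theorem Op.dual_dual {m : ℕ} {V : Type} (o : Op m V) : o.dual.dual = o := by
  cases o <;> rfl

theorem Op.dual_injective {m : ℕ} {V : Type} : Function.Injective (Op.dual (m := m) (V := V)) :=
  Function.LeftInverse.injective Op.dual_dual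

namespace Circuit

variable {m n : ℕ}

/-- The dual circuit: `∧` and `∨` are exchanged. -/
def dual (C : Circuit m n) : Circuit m n where
  V := C.V
  fin := C.fin
  op v := (C.op v).dual
  acyclic := by simpa only [Op.preds_dual] using C.acyclic
  output := C.output

theorem opValue_dual {V : Type} (x : Fin m → Bool) (o : Op m V) (val val' : V → Bool)
    (h : ∀ u ∈ o.preds, val' u = !val u) :
    opValue x o.dual (fun u _ => val' u) = !opValue (fun i => !x i) o fun u _ => val u := by
  cases o with
  | input i => simp [Op.dual, opValue]
  | not u => simp [Op.dual, opValue, h u (by simp [Op.preds])]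
  | and s =>
    rw [Bool.eq_iff_iff]
    simp only [Op.dual, opValue, decide_eq_true_eq, Bool.not_eq_true', decide_eq_false_iff_not,
      not_forall]
    exact exists_congr fun u => exists_congr fun hu => by simp [h u hu]
  | or s =>
    rw [Bool.eq_iff_iff]
    simp only [Op.dual, opValue, decide_eq_true_eq, Bool.not_eq_true', decide_eq_false_iff_not,
      not_exists]
    exact forall_congr' fun u => forall_congr' fun hu => by simp [h u hu]

/-- De Morgan's laws, applied gate by gate along the acyclic predecessor relation. -/
theorem value_dual (C : Circuit m n) (x : Fin m → Bool) (v : C.V) :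
    C.dual.value x v = !C.value (fun i => !x i) v := by
  induction v using C.acyclic.induction with
  | _ v ih =>
    refine (C.dual.value_eq x v).trans ?_
    rw [C.value_eq]
    exact opValue_dual x (C.op v) _ _ ih

theorem eval_dual (C : Circuit m n) (x : Fin m → Bool) :
    C.dual.eval x = fun j => !C.eval (fun i => !x i) j :=
  funext fun j => C.value_dual x (C.output j)

theorem gateDepth_dual (C : Circuit m n) (v : C.V) : C.dual.gateDepth v = C.gateDepth v := by
  induction v using C.acyclic.induction with
  | _ v ih =>
    refine (C.dual.gateDepth_eq v).trans ?_
    rw [gateDepth_eq]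
    change (C.op v).dual.preds.sup _ = _
    rw [Op.preds_dual]
    exact Finset.sup_congr rfl fun u hu => by rw [ih u hu]

end Circuit

/-- The bitwise complements of the words of `L`. -/
def bitwiseNot (L : Language Bool) : Language Bool :=
  {w | w.map not ∈ L}

theorem ofFn_mem_bitwiseNot {L : Language Bool} {n : ℕ} (y : Fin n → Bool) :
    List.ofFn y ∈ bitwiseNot L ↔ List.ofFn (fun i => !y i) ∈ L := by
  change (List.ofFn y).map not ∈ L ↔ _
  rw [List.map_ofFn]; rfl

theorem HasLocalVerifier.bitwiseNot {L : Language Bool} (h : HasLocalVerifier L) :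
    HasLocalVerifier (bitwiseNot L) := by
  obtain ⟨k, p, h⟩ := h
  refine ⟨k, p, fun n => ?_⟩
  obtain ⟨V, U, P, out, hU, hP, hout, hL⟩ := h n
  refine ⟨V, U, _, out, hU, hP.comp_not, hout, fun y => ?_⟩
  rw [ofFn_mem_bitwiseNot, hL]
  constructor
  · rintro ⟨a, ha, hy⟩
    exact ⟨fun v => !a v, by simpa using ha, fun i => by simp [hy]⟩
  · rintro ⟨a, ha, hy⟩
    exact ⟨fun v => !a v, ha, fun i => by simp [hy]⟩

/-- Dualizing complements inputs and outputs. Complementing the inputs does not change the range,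
and complementing the outputs turns the range from words of `bitwiseNot L` into words of `L`. -/
theorem HasCoSAC0ProofSystem.dual {L : Language Bool}
    (h : HasCoSAC0ProofSystem (bitwiseNot L)) : HasSAC0ProofSystem L := by
  obtain ⟨m, C, hC, p, d, c, hp⟩ := h
  refine ⟨m, fun n => (C n).dual, fun n hn ⟨y, hy⟩ => ?_, p, d, c, fun n hn => ?_⟩
  · obtain ⟨h1, h2⟩ := hC n hn ⟨fun i => !y i, by simpa [ofFn_mem_bitwiseNot] using hy⟩
    refine ⟨fun z hz => ?_, fun x => ?_⟩
    · obtain ⟨x, hx⟩ := h1 (fun i => !z i) (by simpa [ofFn_mem_bitwiseNot] using hz)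
      refine ⟨fun i => !x i, ?_⟩
      simp [Circuit.eval_dual, hx]
    · rw [Circuit.eval_dual, ← ofFn_mem_bitwiseNot]
      exact h2 _
  · obtain ⟨h1, h2, h3, h4⟩ := hp n hn
    refine ⟨h1, fun v => (Circuit.gateDepth_dual (C n) v).trans_le (h2 v), fun v u hv => ?_,
      fun v s hv => ?_⟩
    · change ((C n).op v).dual = _ at hv
      obtain ⟨i, hi⟩ := h3 v u (Op.dual_injective hv)
      refine ⟨i, ?_⟩
      change ((C n).op u).dual = _
      rw [hi]; rfl
    · change ((C n).op v).dual = _ at hv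
      exact h4 v s (Op.dual_injective hv)

/-! ### The proof system of a local verifier -/

section CNF

variable {V : Type} {U : Finset V} {n k : ℕ}

/-- The gates of the circuit built from clauses: literals, clauses, and outputs. -/
abbrev CNFGate (U : Finset V) (n k : ℕ) : Type :=
  (U × Bool) ⊕ (Fin k → Option (U × Bool)) ⊕ Fin n

/-- The level of a gate. -/
def CNFGate.rank : CNFGate U n k → ℕ
  | .inl (_, true) => 0
  | .inl (_, false) => 1
  | .inr (.inl _) => 2
  | .inr (.inr _) => 3

open Classical in
/-- The gates of the literals of a clause. -/
noncomputable def CNFGate.literals (f : Fin k → Option (U × Bool)) : Finset (CNFGate U n k) :=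
  (Finset.univ.filter fun l => ∃ j, l ∈ f j).map .inl

open Classical in
/-- The gates of the variable `u` and of the clauses in `F`. -/
noncomputable def CNFGate.conjuncts (F : Set (Fin k → Option (U × Bool))) (u : U) :
    Finset (CNFGate U n k) :=
  insert (.inl (u, true)) ((Finset.univ.filter (· ∈ F)).image fun f => .inr (.inl f))

/-- The label of a gate. -/
noncomputable def CNFGate.op (F : Set (Fin k → Option (U × Bool))) (out : Fin n → U) :
    CNFGate U n k → Op U.card (CNFGate U n k)
  | .inl (u, true) => .input (U.equivFin u)
  | .inl (u, false) => .not (.inl (u, true))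
  | .inr (.inl f) => .or (CNFGate.literals f)
  | .inr (.inr j) => .and (CNFGate.conjuncts F (out j))

theorem CNFGate.mem_literals {f : Fin k → Option (U × Bool)} {v : CNFGate U n k} :
    v ∈ CNFGate.literals f ↔ ∃ j, ∃ l ∈ f j, v = .inl l := by
  simp only [literals, Finset.mem_map, Finset.mem_filter, Finset.mem_univ, true_and,
    Function.Embedding.inl_apply]
  constructor
  · rintro ⟨l, ⟨j, hj⟩, rfl⟩; exact ⟨j, l, hj, rfl⟩
  · rintro ⟨j, l, hj, rfl⟩; exact ⟨l, ⟨j, hj⟩, rfl⟩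

theorem CNFGate.card_literals_le (f : Fin k → Option (U × Bool)) :
    (CNFGate.literals f : Finset (CNFGate U n k)).card ≤ k := by
  rw [literals, Finset.card_map]
  classical
  have : (Finset.univ.filter fun l => ∃ j, l ∈ f j) ⊆ (Finset.univ.image f).eraseNone := by
    intro l hl
    simpa [Finset.mem_eraseNone] using hl
  refine (Finset.card_le_card this).trans ((Finset.card_eraseNone_le _).trans ?_)
  exact Finset.card_image_le.trans (by simp)

theorem CNFGate.mem_conjuncts {F : Set (Fin k → Option (U × Bool))} {u : U}
    {v : CNFGate U n k} :
    v ∈ CNFGate.conjuncts F u ↔ v = .inl (u, true) ∨ ∃ f ∈ F, v = .inr (.inl f) := by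
  simp [conjuncts, eq_comm]

theorem CNFGate.rank_lt (F : Set (Fin k → Option (U × Bool))) (out : Fin n → U)
    (v u : CNFGate U n k) (h : u ∈ (CNFGate.op F out v).preds) : u.rank < v.rank := by
  rcases v with ⟨v, (_ | _)⟩ | f | j
  · simp only [CNFGate.op, Op.preds, Finset.mem_singleton] at h
    subst h; simp [CNFGate.rank]
  · simp [CNFGate.op, Op.preds] at h
  · obtain ⟨j, ⟨w, (_ | _)⟩, -, rfl⟩ := CNFGate.mem_literals (f := f).1 h <;> simp [CNFGate.rank]
  · obtain rfl | ⟨f, -, rfl⟩ := CNFGate.mem_conjuncts.1 h <;> simp [CNFGate.rank]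

/-- The circuit whose `j`-th output bit is the conjunction of the variable `out j` and the
clauses in `F`. -/
noncomputable def cnfCircuit (F : Set (Fin k → Option (U × Bool))) (out : Fin n → U) :
    Circuit U.card n where
  V := CNFGate U n k
  fin := inferInstance
  op := CNFGate.op F out
  acyclic := Subrelation.wf (fun {u v} h => CNFGate.rank_lt F out v u h)
    (measure CNFGate.rank).wf
  output j := .inr (.inr j)

variable (F : Set (Fin k → Option (U × Bool))) (out : Fin n → U)

theorem value_cnfCircuit_literal (x : Fin U.card → Bool) (l : U × Bool) :
    (cnfCircuit F out).value x (.inl l) = true ↔ x (U.equivFin l.1) = l.2 := by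
  have hpos : ∀ u, (cnfCircuit F out).value x (.inl (u, true)) = x (U.equivFin u) := fun u =>
    Circuit.value_of_input _ _ rfl
  obtain ⟨u, (_ | _)⟩ := l
  · have : (cnfCircuit F out).value x (.inl (u, false)) =
        !(cnfCircuit F out).value x (.inl (u, true)) := Circuit.value_of_not _ _ rfl
    rw [hpos] at this
    simp [this]
  · simp [hpos]

theorem value_cnfCircuit_clause (x : Fin U.card → Bool) (f : Fin k → Option (U × Bool)) :
    (cnfCircuit F out).value x (.inr (.inl f)) = true ↔
      ClauseHolds f fun u => x (U.equivFin u) := by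
  refine (Circuit.value_of_or _ x (s := CNFGate.literals f) rfl).trans ⟨?_, ?_⟩
  · rintro ⟨u, hu, h⟩
    obtain ⟨j, l, hj, rfl⟩ := CNFGate.mem_literals.1 hu
    exact ⟨j, l, hj, (value_cnfCircuit_literal F out x l).1 h⟩
  · rintro ⟨j, l, hj, h⟩
    exact ⟨.inl l, CNFGate.mem_literals.2 ⟨j, l, hj, rfl⟩,
      (value_cnfCircuit_literal F out x l).2 h⟩

theorem eval_cnfCircuit (x : Fin U.card → Bool) (j : Fin n) :
    (cnfCircuit F out).eval x j = true ↔
      x (U.equivFin (out j)) = true ∧ ∀ f ∈ F, ClauseHolds f fun u => x (U.equivFin u) := by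
  refine (Circuit.value_of_and _ x (s := CNFGate.conjuncts F (out j)) rfl).trans ⟨fun h => ?_, ?_⟩
  · exact ⟨(value_cnfCircuit_literal F out x (out j, true)).1
      (h _ (CNFGate.mem_conjuncts.2 (.inl rfl))), fun f hf =>
        (value_cnfCircuit_clause F out x f).1 (h _ (CNFGate.mem_conjuncts.2 (.inr ⟨f, hf, rfl⟩)))⟩
  · rintro ⟨h0, h⟩ u hu
    obtain rfl | ⟨f, hf, rfl⟩ := CNFGate.mem_conjuncts.1 hu
    · exact (value_cnfCircuit_literal F out x (out j, true)).2 h0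
    · exact (value_cnfCircuit_clause F out x f).2 (h f hf)

theorem size_cnfCircuit :
    (cnfCircuit F out).size = U.card + (U.card * 2 + ((U.card * 2 + 1) ^ k + n)) := by
  change U.card + Fintype.card (CNFGate U n k) = _
  simp

theorem depthLE_cnfCircuit : (cnfCircuit F out).DepthLE 3 := fun v =>
  (Circuit.gateDepth_le_of_rank _ CNFGate.rank (CNFGate.rank_lt F out) v).trans (by
    rcases v with ⟨v, (_ | _)⟩ | f | j <;> simp [CNFGate.rank])

theorem negationsAtLeaves_cnfCircuit : (cnfCircuit F out).NegationsAtLeaves := by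
  intro v u h
  change CNFGate.op F out v = _ at h
  rcases v with ⟨v, (_ | _)⟩ | f | j <;> simp only [CNFGate.op, reduceCtorEq] at h
  cases h
  exact ⟨_, rfl⟩

theorem orFaninLE_cnfCircuit : (cnfCircuit F out).OrFaninLE k := by
  intro v s h
  change CNFGate.op F out v = _ at h
  rcases v with ⟨v, (_ | _)⟩ | f | j <;> simp only [CNFGate.op, reduceCtorEq] at h
  cases h
  exact CNFGate.card_literals_le f

end CNF

theorem kstar_singleton_ofFn {n : ℕ} (b : Bool) (y : Fin n → Bool) :
    List.ofFn y ∈ ({[b]} : Language Bool)∗ ↔ ∀ i, y i = b := by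
  rw [Language.mem_kstar]
  constructor
  · rintro ⟨S, hS, hmem⟩ i
    have : y i ∈ S.flatten := hS ▸ List.mem_ofFn.2 ⟨i, rfl⟩
    obtain ⟨l, hl, hy⟩ := List.mem_flatten.1 this
    have := hmem l hl
    change l = [b] at this
    simpa [this] using hy
  · intro h
    refine ⟨List.replicate n [b], ?_, fun l hl => List.eq_of_mem_replicate hl⟩
    rw [funext h, List.ofFn_const]
    induction n with
    | zero => rfl
    | succ n ih => simp [List.replicate_succ]

/-- The circuit is `cnfCircuit` with all width-`k` clauses implied by the local predicate; an
assignment violating one of them is sent to the all-zero word. -/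
theorem HasLocalVerifier.hasCoSAC0ProofSystem {L : Language Bool} (h : HasLocalVerifier L)
    (h0 : ({[false]} : Language Bool)∗ ≤ L) : HasCoSAC0ProofSystem L := by
  obtain ⟨k, p, h⟩ := h
  choose V U P out hU hP hout hL using h
  let F (n : ℕ) : Set (Fin k → Option (U n × Bool)) :=
    {f | ∀ b, P n b → ClauseHolds f fun u => b u}
  refine ⟨fun n => (U n).card, fun n => cnfCircuit (F n) fun i => ⟨out n i, hout n i⟩,
    fun n _ _ => ?_, 1 * p + (p * 2 + ((p * 2 + 1) ^ k + Polynomial.X)), 3, k, fun n _ => ⟨?_,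
      depthLE_cnfCircuit _ _, negationsAtLeaves_cnfCircuit _ _, orFaninLE_cnfCircuit _ _⟩⟩
  · refine ⟨fun y hy => ?_, fun x => ?_⟩
    · obtain ⟨a, ha, hay⟩ := (hL n y).1 hy
      refine ⟨fun i => a ((U n).equivFin.symm i), funext fun j => ?_⟩
      rw [Bool.eq_iff_iff, eval_cnfCircuit]
      simp only [Equiv.symm_apply_apply, hay]
      exact ⟨fun h => h.1, fun h => ⟨h, fun f hf => hf a ha⟩⟩
    · by_cases hx : ∀ f ∈ F n, ClauseHolds f fun u => x ((U n).equivFin u)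
      · classical
        -- The circuit only receives the variables in `U n`. The others may be set to `false`, since
        -- neither the clauses nor the outputs mention them.
        let a : V n → Bool := fun v => if hv : v ∈ U n then x ((U n).equivFin ⟨v, hv⟩) else false
        have hax : (fun u : U n => a u) = fun u => x ((U n).equivFin u) :=
          funext fun u => by simp [a]
        refine (hL n _).2 ⟨a, ((hP n).iff_clauses a).2 fun f hf => hax ▸ hx f hf, fun i => ?_⟩
        rw [Bool.eq_iff_iff, eval_cnfCircuit]
        simpa [a, hout] using fun _ => hx
      · refine h0 ((kstar_singleton_ofFn _ _).2 fun i => ?_)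
        rw [← Bool.not_eq_true, eval_cnfCircuit]
        exact fun h => hx h.2
  · rw [size_cnfCircuit]
    simp only [Polynomial.eval_add, Polynomial.eval_mul, Polynomial.eval_pow, Polynomial.eval_X,
      Polynomial.eval_one, Polynomial.eval_ofNat, one_mul]
    have := hU n
    gcongr

/-! ### Locality of a step of a stack machine -/

section StackMachine

variable {K : Type} {Γ : K → Type} {Λ σ : Type}

/-- Two configurations agree on their control (label and internal state), or on the `i`-th symbol
from the top of the stack `k`. -/
def AgreeAt (X X' : TM2.Cfg Γ Λ σ) : Option (K × ℕ) → Prop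
  | none => X.l = X'.l ∧ X.var = X'.var
  | some (k, i) => (X.stk k)[i]? = (X'.stk k)[i]?

/-- All stacks have length at most `h` and consist of symbols from `G`. -/
def StacksIn (G : Finset (Σ k, Γ k)) (h : ℕ) (S : ∀ k, List (Γ k)) : Prop :=
  ∀ k, (S k).length ≤ h ∧ ∀ γ ∈ S k, ⟨k, γ⟩ ∈ G

theorem StacksIn.mono {G : Finset (Σ k, Γ k)} {h h' : ℕ} {S : ∀ k, List (Γ k)}
    (hS : StacksIn G h S) (hh : h ≤ h') : StacksIn G h' S :=
  fun k => ⟨(hS k).1.trans hh, (hS k).2⟩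

variable [DecidableEq K]

/-- Each part of the result of a statement depends on boundedly many stack positions. -/
theorem stepAux_local (q : TM2.Stmt Γ Λ σ) : ∃ c : ℕ, ∀ o : Option (K × ℕ),
    ∃ N : Finset (K × ℕ), N.card ≤ c ∧ ∀ (v : σ) (S S' : ∀ k, List (Γ k)),
      (∀ p ∈ N, (S p.1)[p.2]? = (S' p.1)[p.2]?) →
        AgreeAt (TM2.stepAux q v S) (TM2.stepAux q v S') o := by
  induction q with
  | push k f q ih =>
    obtain ⟨c, ih⟩ := ih
    refine ⟨c, fun o => ?_⟩
    obtain ⟨N, hN, h⟩ := ih o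
    -- After a push, place `i + 1` holds the former place `i`. Place `0` holds the pushed symbol,
    -- which depends on `v` alone; truncated subtraction sends it to a harmless extra place `0`.
    refine ⟨N.image fun p => if p.1 = k then (k, p.2 - 1) else p,
      Finset.card_image_le.trans hN, fun v S S' hS => ?_⟩
    rw [TM2.stepAux, TM2.stepAux]
    refine h _ _ _ ?_
    rintro ⟨k', i⟩ hp
    have := hS _ (Finset.mem_image_of_mem _ hp)
    by_cases hk : k' = k
    · subst hk
      cases i with
      | zero => simp
      | succ i => rw [if_pos rfl] at this; simpa using this
    · rw [if_neg hk] at this; simpa [hk] using this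
  | peek k f q ih =>
    obtain ⟨c, ih⟩ := ih
    refine ⟨c + 1, fun o => ?_⟩
    obtain ⟨N, hN, h⟩ := ih o
    refine ⟨insert (k, 0) N, (Finset.card_insert_le _ _).trans (Nat.succ_le_succ hN),
      fun v S S' hS => ?_⟩
    rw [TM2.stepAux, TM2.stepAux]
    have h0 := hS (k, 0) (Finset.mem_insert_self _ _)
    simp only [← List.head?_eq_getElem?] at h0
    rw [h0]
    exact h _ _ _ fun p hp => hS p (Finset.mem_insert_of_mem hp)
  | pop k f q ih =>
    obtain ⟨c, ih⟩ := ih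
    refine ⟨c + 1, fun o => ?_⟩
    obtain ⟨N, hN, h⟩ := ih o
    -- The top symbol enters the internal state, hence `(k, 0)`; the remaining places of the stack
    -- move up by one.
    refine ⟨insert (k, 0) (N.image fun p => if p.1 = k then (k, p.2 + 1) else p),
      (Finset.card_insert_le _ _).trans (Nat.succ_le_succ (Finset.card_image_le.trans hN)),
      fun v S S' hS => ?_⟩
    rw [TM2.stepAux, TM2.stepAux]
    have h0 := hS (k, 0) (Finset.mem_insert_self _ _)
    simp only [← List.head?_eq_getElem?] at h0
    rw [h0]
    refine h _ _ _ ?_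
    rintro ⟨k', i⟩ hp
    have := hS _ (Finset.mem_insert_of_mem (Finset.mem_image_of_mem _ hp))
    by_cases hk : k' = k
    · subst hk
      rw [if_pos rfl] at this
      simpa [List.getElem?_tail] using this
    · rw [if_neg hk] at this; simpa [hk] using this
  | load f q ih =>
    obtain ⟨c, ih⟩ := ih
    refine ⟨c, fun o => (ih o).imp fun N hN => ⟨hN.1, fun v S S' hS => ?_⟩⟩
    rw [TM2.stepAux, TM2.stepAux]
    exact hN.2 _ _ _ hS
  | branch f q₁ q₂ ih₁ ih₂ =>
    obtain ⟨c₁, ih₁⟩ := ih₁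
    obtain ⟨c₂, ih₂⟩ := ih₂
    refine ⟨c₁ + c₂, fun o => ?_⟩
    obtain ⟨N₁, hN₁, h₁⟩ := ih₁ o
    obtain ⟨N₂, hN₂, h₂⟩ := ih₂ o
    refine ⟨N₁ ∪ N₂, (Finset.card_union_le _ _).trans (add_le_add hN₁ hN₂), fun v S S' hS => ?_⟩
    rw [TM2.stepAux, TM2.stepAux]
    cases f v
    · exact h₂ _ _ _ fun p hp => hS p (Finset.mem_union_right _ hp)
    · exact h₁ _ _ _ fun p hp => hS p (Finset.mem_union_left _ hp)
  | goto f =>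
    refine ⟨1, fun o => ⟨o.toFinset, by cases o <;> simp, fun v S S' hS => ?_⟩⟩
    rw [TM2.stepAux, TM2.stepAux]
    rcases o with _ | p
    · exact ⟨rfl, rfl⟩
    · exact hS p (by simp)
  | halt =>
    refine ⟨1, fun o => ⟨o.toFinset, by cases o <;> simp, fun v S S' hS => ?_⟩⟩
    rw [TM2.stepAux, TM2.stepAux]
    rcases o with _ | p
    · exact ⟨rfl, rfl⟩
    · exact hS p (by simp)

/-- A statement uses finitely many symbols and increases the stacks by a bounded amount. -/
theorem stepAux_stacksIn [Finite σ] (q : TM2.Stmt Γ Λ σ) :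
    ∃ (G : Finset (Σ k, Γ k)) (c : ℕ), ∀ G', G ⊆ G' → ∀ (v : σ) (h : ℕ) (S : ∀ k, List (Γ k)),
      StacksIn G' h S → StacksIn G' (h + c) (TM2.stepAux q v S).stk := by
  classical
  have := Fintype.ofFinite σ
  induction q with
  | push k f q ih =>
    obtain ⟨G, c, ih⟩ := ih
    -- The pushed symbol is a function of the internal state, so finitely many symbols suffice even
    -- if the stack alphabet is infinite.
    refine ⟨Finset.univ.image (fun v => ⟨k, f v⟩) ∪ G, 1 + c, fun G' hG v h S hS => ?_⟩
    rw [TM2.stepAux, ← add_assoc]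
    refine ih G' (Finset.union_subset_right hG) _ _ _ fun k' => ?_
    by_cases hk : k' = k
    · subst hk
      have := hS k'
      simp only [Function.update_self, List.length_cons, List.mem_cons, forall_eq_or_imp]
      exact ⟨Nat.succ_le_succ this.1,
        hG (Finset.mem_union_left _ (Finset.mem_image_of_mem _ (Finset.mem_univ v))), this.2⟩
    · simpa [Function.update_of_ne hk] using hS.mono (Nat.le_succ h) k'
  | peek k f q ih =>
    obtain ⟨G, c, ih⟩ := ih
    exact ⟨G, c, fun G' hG v h S hS => ih G' hG _ _ _ hS⟩
  | pop k f q ih =>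
    obtain ⟨G, c, ih⟩ := ih
    refine ⟨G, c, fun G' hG v h S hS => ?_⟩
    rw [TM2.stepAux]
    refine ih G' hG _ _ _ fun k' => ?_
    by_cases hk : k' = k
    · subst hk
      have := hS k'
      simp only [Function.update_self, List.length_tail]
      exact ⟨by omega, fun γ hγ => this.2 γ (List.mem_of_mem_tail hγ)⟩
    · simpa [Function.update_of_ne hk] using hS k'
  | load f q ih =>
    obtain ⟨G, c, ih⟩ := ih
    exact ⟨G, c, fun G' hG v h S hS => ih G' hG _ _ _ hS⟩
  | branch f q₁ q₂ ih₁ ih₂ =>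
    obtain ⟨G₁, c₁, ih₁⟩ := ih₁
    obtain ⟨G₂, c₂, ih₂⟩ := ih₂
    refine ⟨G₁ ∪ G₂, c₁ + c₂, fun G' hG v h S hS => ?_⟩
    rw [TM2.stepAux]
    cases f v
    · exact (ih₂ G' (Finset.union_subset_right hG) _ _ _ hS).mono (by omega)
    · exact (ih₁ G' (Finset.union_subset_left hG) _ _ _ hS).mono (by omega)
  | goto f => exact ⟨∅, 0, fun G' _ v h S hS => hS⟩
  | halt => exact ⟨∅, 0, fun G' _ v h S hS => hS⟩

/-- One step of the machine; halting configurations are left unchanged. -/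
def stepOrStay (M : Λ → TM2.Stmt Γ Λ σ) (X : TM2.Cfg Γ Λ σ) : TM2.Cfg Γ Λ σ :=
  (TM2.step M X).getD X

/-- The places needed by all labels are collected, together with `o` itself for the halted
configurations, which are copied. -/
theorem stepOrStay_local [Finite Λ] (M : Λ → TM2.Stmt Γ Λ σ) : ∃ c : ℕ, ∀ o : Option (K × ℕ),
    ∃ N : Finset (K × ℕ), N.card ≤ c ∧ ∀ X X' : TM2.Cfg Γ Λ σ, AgreeAt X X' none →
      (∀ p ∈ N, AgreeAt X X' (some p)) → AgreeAt (stepOrStay M X) (stepOrStay M X') o := by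
  classical
  have := Fintype.ofFinite Λ
  choose c N hN h using fun l => stepAux_local (M l)
  refine ⟨1 + ∑ l, c l, fun o => ⟨o.toFinset ∪ Finset.univ.biUnion fun l => N l o, ?_, ?_⟩⟩
  · refine (Finset.card_union_le _ _).trans (add_le_add (by cases o <;> simp) ?_)
    exact Finset.card_biUnion_le.trans (Finset.sum_le_sum fun l _ => hN l o)
  · rintro ⟨l, v, S⟩ ⟨l', v', S'⟩ ⟨hl, hv⟩ hS
    dsimp only at hl hv
    subst hl hv
    rcases l with _ | l
    · rcases o with _ | p
      · exact ⟨rfl, rfl⟩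
      · exact hS p (by simp)
    · exact h l o v S S' fun p hp => hS p (by simp; exact .inr ⟨l, hp⟩)

theorem stepOrStay_stacksIn [Finite Λ] [Finite σ] (M : Λ → TM2.Stmt Γ Λ σ) :
    ∃ (G : Finset (Σ k, Γ k)) (c : ℕ), ∀ G', G ⊆ G' → ∀ (h : ℕ) (X : TM2.Cfg Γ Λ σ),
      StacksIn G' h X.stk → StacksIn G' (h + c) (stepOrStay M X).stk := by
  classical
  have := Fintype.ofFinite Λ
  choose G c h using fun l => stepAux_stacksIn (M l)
  refine ⟨Finset.univ.biUnion G, ∑ l, c l, fun G' hG b X hX => ?_⟩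
  obtain ⟨_ | l, v, S⟩ := X
  · exact hX.mono (Nat.le_add_right _ _)
  · exact (h l G' ((Finset.subset_biUnion_of_mem G (Finset.mem_univ l)).trans hG) v b S hX).mono
      (Nat.add_le_add_left (Finset.single_le_sum (fun _ _ => Nat.zero_le _) (Finset.mem_univ l)) _)

theorem iterate_stepOrStay_stacksIn {M : Λ → TM2.Stmt Γ Λ σ} {G : Finset (Σ k, Γ k)} {c : ℕ}
    (hM : ∀ (h : ℕ) (X : TM2.Cfg Γ Λ σ),
      StacksIn G h X.stk → StacksIn G (h + c) (stepOrStay M X).stk)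
    {h : ℕ} {X : TM2.Cfg Γ Λ σ} (hX : StacksIn G h X.stk) (t : ℕ) :
    StacksIn G (h + c * t) ((stepOrStay M)^[t] X).stk := by
  induction t with
  | zero => exact hX
  | succ t ih =>
    rw [Function.iterate_succ_apply', Nat.mul_succ, ← add_assoc]
    exact hM _ _ ih

/-- If the machine evaluates to a halting configuration, this is also what is reached after any
larger number of steps. -/
theorem iterate_stepOrStay_of_evalsToInTime {M : Λ → TM2.Stmt Γ Λ σ} {X Y : TM2.Cfg Γ Λ σ}
    {t T : ℕ} (h : StateTransition.EvalsToInTime (TM2.step M) X (some Y) t) (hY : Y.l = none)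
    (hT : t ≤ T) : (stepOrStay M)^[T] X = Y := by
  have hstay : ∀ s, (stepOrStay M)^[s] Y = Y := by
    intro s
    refine Function.iterate_fixed ?_ s
    obtain ⟨l, v, S⟩ := Y
    dsimp only at hY
    subst hY
    rfl
  have hrun : ∀ (s : ℕ) (X : TM2.Cfg Γ Λ σ),
      (flip bind (TM2.step M))^[s] (some X) = some Y → (stepOrStay M)^[s] X = Y := by
    intro s
    induction s with
    | zero => intro X h; simpa using h
    | succ s ih =>
      intro X h
      rw [Function.iterate_succ_apply] at h ⊢
      change (flip bind (TM2.step M))^[s] (TM2.step M X) = _ at h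
      cases hX : TM2.step M X with
      | some Z =>
        rw [hX] at h
        rw [stepOrStay, hX]
        exact ih Z h
      | none =>
        have hn : ∀ s, (flip bind (TM2.step M))^[s] none = none :=
          fun s => Function.iterate_fixed rfl s
        rw [hX, hn] at h
        simp at h
  obtain ⟨s, rfl⟩ := Nat.exists_eq_add_of_le' ((h.steps_le_m).trans hT)
  rw [Function.iterate_add_apply, hrun _ X h.evals_in_steps, hstay]

end StackMachine

/-! ### Words given by consecutive pairs of letters -/

/-- The encodings of pairs of a word of length `n` and a word of length at most `P`. -/
def IsPairCode (n P : ℕ) (w : List (Bool ⊕ Bool)) : Prop :=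
  ∃ x y : List Bool, x.length = n ∧ y.length ≤ P ∧ w = encodePair (x, y)

theorem encodePair_eq (x y : List Bool) :
    encodePair (x, y) = x.map .inl ++ y.map .inr := rfl

/-- A sequence of letters is the encoding of a pair if any two consecutive letters occur at their
place in the encoding of a pair. -/
theorem exists_isPairCode {n P : ℕ} (w : ℕ → List (Bool ⊕ Bool)) (hw : ∀ i, IsPairCode n P (w i))
    (h : ∀ i, (w i)[i + 1]? = (w (i + 1))[i + 1]?) :
    ∃ w', IsPairCode n P w' ∧ ∀ i, w'[i]? = (w i)[i]? := by
  have hlen : ∀ i, n ≤ (w i).length ∧ (w i).length ≤ n + P := by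
    intro i
    obtain ⟨x, y, hx, hy, hxy⟩ := hw i
    rw [hxy, encodePair_eq]; simp; omega
  have hl : ∀ i < n, ∃ b, (w i)[i]? = some (.inl b) := by
    intro i hi
    obtain ⟨x, y, hx, hy, hxy⟩ := hw i
    rw [hxy, encodePair_eq, List.getElem?_append_left (by simpa [hx] using hi)]
    exact ⟨x[i], by simp⟩
  have hr : ∀ i, n ≤ i → ∀ l, (w i)[i]? = some l → ∃ b, l = .inr b := by
    intro i hi l hl
    obtain ⟨x, y, hx, hy, hxy⟩ := hw i
    rw [hxy, encodePair_eq, List.getElem?_append_right (by simpa [hx] using hi)] at hl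
    simp only [List.getElem?_map, Option.map_eq_some_iff] at hl
    obtain ⟨b, -, rfl⟩ := hl
    exact ⟨b, rfl⟩
  -- The glued word is the diagonal `i ↦ (w i)[i]?`. Agreement of neighbours shows that once it ends
  -- it never resumes; its length `m` lies between `n` and `n + P`.
  have hnone : ∀ i, (w i)[i]? = none → ∀ j, i ≤ j → (w j)[j]? = none := by
    intro i hi j hij
    induction j, hij using Nat.le_induction with
    | base => exact hi
    | succ j _ ih =>
      rw [← h j]
      rw [List.getElem?_eq_none_iff] at ih ⊢
      omega
  have hex : ∃ i, (w i)[i]? = none :=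
    ⟨n + P, List.getElem?_eq_none_iff.2 (hlen _).2⟩
  classical
  let m := Nat.find hex
  have hm : (w m)[m]? = none := Nat.find_spec hex
  have hmn : n ≤ m := by
    by_contra! hlt
    obtain ⟨b, hb⟩ := hl m hlt
    simp [hm] at hb
  have hmP : m ≤ n + P := Nat.find_min' hex (List.getElem?_eq_none_iff.2 (hlen _).2)
  have hsome : ∀ i < m, ∃ l, (w i)[i]? = some l := fun i hi =>
    Option.ne_none_iff_exists'.1 (Nat.find_min hex hi)
  have hr' : ∀ j : Fin (m - n), ∃ b, (w (n + j))[n + j.1]? = some (.inr b) := by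
    intro j
    obtain ⟨l, hj⟩ := hsome (n + j) (by omega)
    obtain ⟨b, rfl⟩ := hr _ (by omega) l hj
    exact ⟨b, hj⟩
  choose x hx using fun i : Fin n => hl i i.2
  choose y hy using hr'
  refine ⟨encodePair (List.ofFn x, List.ofFn y), ⟨_, _, by simp, by simp; omega, rfl⟩,
    fun i => ?_⟩
  rw [encodePair_eq]
  rcases lt_or_ge i n with hi | hi
  · rw [List.getElem?_append_left (by simpa using hi), hx ⟨i, hi⟩]
    simp [hi]
  · rw [List.getElem?_append_right (by simpa using hi)]
    rcases lt_or_ge i m with him | him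
    · have := hy ⟨i - n, by omega⟩
      simp only [Nat.add_sub_cancel' hi] at this
      rw [this]
      have : i - n < m - n := by omega
      simp [this]
    · rw [hnone m hm i him]
      simp
      omega

/-! ### Tableaux -/

section Tableau

variable {X Pos : Type*} (step : X → X) (code : X → Pos → Bool) (Good : X → Prop)
  (N : Pos → Finset Pos) (D : Finset Pos) (T : ℕ)

open Classical in
/-- The rows `a (t, ·)`, restricted to the positions in `D`, follow the transition function `step`
at the times `t < T`; the entry at `p` is determined by those at `N p` in the previous row. -/
def Transitions (a : ℕ × Pos → Bool) : Prop :=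
  ∀ t : Fin T, ∀ p : D, ∀ x, Good x →
    (∀ q ∈ N p, (if q ∈ D then a (t, q) else false) = code x q) → a (t + 1, p) = code (step x) p

variable {step code Good N D T}

/-- Each instance reads one entry of row `t + 1` and at most `c` entries of row `t`; the conjunction
over all instances costs nothing. -/
theorem isLocalOn_transitions {c : ℕ} (hN : ∀ p, (N p).card ≤ c) :
    IsLocalOn (Finset.range (T + 1) ×ˢ D) (c + 1) (Transitions step code Good N D T) := by
  classical
  refine .forall fun t => .forall fun p => ?_
  refine isLocalOn_of_agree
    (S := insert (t.1 + 1, p.1) (((N p).filter (· ∈ D)).image fun q => (t.1, q))) ?_ ?_ ?_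
  · refine Finset.insert_subset (by simp) (Finset.image_subset_iff.2 fun q hq => ?_)
    rw [Finset.mem_filter] at hq
    simp [hq.2]
  · exact (Finset.card_insert_le _ _).trans (Nat.succ_le_succ
      (Finset.card_image_le.trans ((Finset.card_filter_le _ _).trans (hN p))))
  · intro a b hab hb x hx hq
    rw [hab _ (Finset.mem_insert_self _ _)]
    refine hb x hx fun q hqN => ?_
    rw [← hq q hqN]
    split_ifs with hqD
    · exact (hab _ (Finset.mem_insert_of_mem (Finset.mem_image_of_mem _
        (Finset.mem_filter.2 ⟨hqN, hqD⟩)))).symm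
    · rfl

variable {x : X} (hx : ∀ t ≤ T, Good (step^[t] x) ∧ ∀ p ∉ D, code (step^[t] x) p = false)
include hx

theorem transitions_of_run (hloc : ∀ p x x', Good x → Good x' →
      (∀ q ∈ N p, code x q = code x' q) → code (step x) p = code (step x') p) :
    Transitions step code Good N D T fun q => code (step^[q.1] x) q.2 := by
  classical
  intro t p x' hx' hq
  change code (step^[t + 1] x) p = _
  rw [Function.iterate_succ_apply']
  refine hloc p _ _ (hx t t.2.le).1 hx' fun q hqN => ?_
  rw [← hq q hqN]
  split_ifs with hqD
  · rfl
  · exact (hx t t.2.le).2 q hqD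

/-- A correct first row forces the whole tableau. Reading `false` outside `D` is right because the
codes along the run vanish there. -/
theorem Transitions.eq_run {a : ℕ × Pos → Bool} (ha : Transitions step code Good N D T a)
    (h0 : ∀ p ∈ D, a (0, p) = code x p) (t : ℕ) (ht : t ≤ T) :
    ∀ p ∈ D, a (t, p) = code (step^[t] x) p := by
  classical
  induction t with
  | zero => exact h0
  | succ t ih =>
    intro p hp
    rw [Function.iterate_succ_apply']
    refine ha ⟨t, ht⟩ ⟨p, hp⟩ _ (hx t (by omega)).1 fun q _ => ?_
    split_ifs with hqD
    · exact ih (by omega) q hqD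
    · exact ((hx t (by omega)).2 q hqD).symm

end Tableau

/-! ### Binary codes of configurations of stack machines -/

section Code

variable {K : Type} {Γ : K → Type} {Λ σ : Type}

variable (Γ Λ σ) in
/-- A position in the code of a configuration: a possible control, or a symbol and a distance from
the top of its stack. -/
abbrev CodePos : Type := (Option Λ × σ) ⊕ ((Σ k, Γ k) × ℕ)

open Classical in
/-- The code of a configuration tells for each possible control if it is the actual one, and for
each place of a stack and each symbol if the symbol is there. -/
noncomputable def code (X : TM2.Cfg Γ Λ σ) : CodePos Γ Λ σ → Bool
  | .inl c => decide (X.l = c.1 ∧ X.var = c.2)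
  | .inr (γ, i) => decide ((X.stk γ.1)[i]? = some γ.2)

/-- The part of a configuration that a position of its code is about. -/
def CodePos.part : CodePos Γ Λ σ → Option (K × ℕ)
  | .inl _ => none
  | .inr (γ, i) => some (γ.1, i)

theorem AgreeAt.code_eq {X X' : TM2.Cfg Γ Λ σ} {p : CodePos Γ Λ σ} (h : AgreeAt X X' p.part) :
    code X p = code X' p := by
  rcases p with c | ⟨γ, i⟩
  · have h' : X.l = X'.l ∧ X.var = X'.var := h
    rw [Bool.eq_iff_iff]
    simp only [code, decide_eq_true_eq, h'.1, h'.2]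
  · have h' : (X.stk γ.1)[i]? = (X'.stk γ.1)[i]? := h
    rw [Bool.eq_iff_iff]
    simp only [code, decide_eq_true_eq, h']

theorem agreeAt_none_of_code {X X' : TM2.Cfg Γ Λ σ} (h : ∀ c, code X (.inl c) = code X' (.inl c)) :
    AgreeAt X X' none := by
  have := h (X'.l, X'.var)
  simpa [code, AgreeAt] using this

/-- The code bits for symbols of `G` determine the entry at a place because no other symbol occurs
on the stacks. -/
theorem agreeAt_some_of_code {X X' : TM2.Cfg Γ Λ σ} {G : Finset (Σ k, Γ k)} {b b' i : ℕ}
    (hX : StacksIn G b X.stk) (hX' : StacksIn G b' X'.stk)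
    (h : ∀ γ ∈ G, code X (.inr (γ, i)) = code X' (.inr (γ, i))) (k : K) :
    AgreeAt X X' (some (k, i)) := by
  refine Option.ext fun γ => ⟨fun hγ => ?_, fun hγ => ?_⟩
  · have := h ⟨k, γ⟩ ((hX k).2 γ (List.mem_of_getElem? hγ))
    simp only [code, hγ, decide_true] at this
    simpa using this.symm
  · have := h ⟨k, γ⟩ ((hX' k).2 γ (List.mem_of_getElem? hγ))
    simp only [code, hγ, decide_true] at this
    simpa using this

variable [Fintype Λ] [Fintype σ]

/-- The positions for all controls, and for the symbols in `G` at the places in `I`. -/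
def cells (G : Finset (Σ k, Γ k)) (I : Finset ℕ) : Finset (CodePos Γ Λ σ) :=
  Finset.univ.disjSum (G ×ˢ I)

theorem card_cells (G : Finset (Σ k, Γ k)) (I : Finset ℕ) :
    (cells (Λ := Λ) (σ := σ) G I).card = Fintype.card (Option Λ × σ) + G.card * I.card := by
  rw [cells, Finset.card_disjSum, Finset.card_product, Finset.card_univ]

theorem inl_mem_cells {G : Finset (Σ k, Γ k)} {I : Finset ℕ} (c : Option Λ × σ) :
    .inl c ∈ cells G I := by
  simp [cells]

theorem inr_mem_cells {G : Finset (Σ k, Γ k)} {I : Finset ℕ} {γ : Σ k, Γ k} {i : ℕ} :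
    .inr (γ, i) ∈ cells (Λ := Λ) (σ := σ) G I ↔ γ ∈ G ∧ i ∈ I := by
  simp [cells]

theorem code_eq_false_of_notMem {X : TM2.Cfg Γ Λ σ} {G : Finset (Σ k, Γ k)} {h : ℕ}
    (hX : StacksIn G h X.stk) {p : CodePos Γ Λ σ} (hp : p ∉ cells G (Finset.range h)) :
    code X p = false := by
  rcases p with c | ⟨γ, i⟩
  · exact absurd (inl_mem_cells c) hp
  · rw [inr_mem_cells] at hp
    simp only [code, decide_eq_false_iff_not]
    intro hi
    refine hp ⟨(hX γ.1).2 γ.2 (List.mem_of_getElem? hi), ?_⟩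
    have := (List.getElem?_eq_some_iff.1 hi).1
    exact Finset.mem_range.2 (this.trans_le (hX γ.1).1)

/-- Each bit of the code of the next configuration depends on boundedly many bits of the code. -/
theorem code_stepOrStay_local [DecidableEq K] (M : Λ → TM2.Stmt Γ Λ σ) (G : Finset (Σ k, Γ k)) :
    ∃ c : ℕ, ∀ p : CodePos Γ Λ σ, ∃ N : Finset (CodePos Γ Λ σ), N.card ≤ c ∧
      ∀ (b b' : ℕ) (X X' : TM2.Cfg Γ Λ σ), StacksIn G b X.stk → StacksIn G b' X'.stk →
        (∀ q ∈ N, code X q = code X' q) → code (stepOrStay M X) p = code (stepOrStay M X') p := by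
  obtain ⟨c, hc⟩ := stepOrStay_local M
  refine ⟨Fintype.card (Option Λ × σ) + G.card * c, fun p => ?_⟩
  obtain ⟨N, hN, h⟩ := hc p.part
  -- It is enough to read every control and, at each relevant distance from the top, every symbol of
  -- `G` on every stack.
  refine ⟨cells G (N.image Prod.snd), ?_, fun b b' X X' hX hX' hq => ?_⟩
  · rw [card_cells]
    gcongr
    exact Finset.card_image_le.trans hN
  · refine (h X X' (agreeAt_none_of_code fun c => hq _ (inl_mem_cells c)) ?_).code_eq
    exact fun q hqN => agreeAt_some_of_code hX hX' (fun γ hγ =>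
      hq _ (inr_mem_cells.2 ⟨hγ, Finset.mem_image_of_mem _ hqN⟩)) q.1

end Code

theorem polynomial_eval_mono (p : Polynomial ℕ) : Monotone fun n => p.eval n := by
  intro m n h
  simp only [Polynomial.eval_eq_sum_range]
  gcongr

/-! ### Languages in NP have local verifiers -/

theorem initList_stk_self (tm : FinTM2) (s : List (tm.Γ tm.k₀)) :
    (initList tm s).stk tm.k₀ = s := by
  simp [initList]

theorem initList_stk_of_ne (tm : FinTM2) (s : List (tm.Γ tm.k₀)) {k : tm.K} (h : k ≠ tm.k₀) :
    (initList tm s).stk k = [] := by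
  simp [initList, h]

theorem haltList_stk_self (tm : FinTM2) (s : List (tm.Γ tm.k₁)) :
    (haltList tm s).stk tm.k₁ = s := by
  simp [haltList]

/-- The variables are the code bits of the configurations at times `0, …, time n`. The predicate
says that the first row looks locally like a start on some pair `(x, y)`, that rows follow the
machine, and that the last row outputs `true`. The certificate `y`, including its length, is left
free in the first row. -/
theorem InNP.hasLocalVerifier {L : Language Bool} (hL : InNP L) : HasLocalVerifier L := by
  classical
  obtain ⟨p, R, ⟨M⟩, hL⟩ := hL
  let tm := M.tm
  let _ : Fintype tm.Λ := tm.ΛFin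
  let _ : Fintype tm.σ := tm.σFin
  let _ : Fintype (tm.Γ tm.k₀) := tm.Γk₀Fin
  obtain ⟨G₀, c₀, hG₀⟩ := stepOrStay_stacksIn tm.m
  let outTrue : Σ k, tm.Γ k := ⟨tm.k₁, M.outputAlphabet.symm true⟩
  let G : Finset (Σ k, tm.Γ k) :=
    insert outTrue (G₀ ∪ Finset.univ.image fun γ : tm.Γ tm.k₀ => ⟨tm.k₀, γ⟩)
  have hG : ∀ γ : tm.Γ tm.k₀, ⟨tm.k₀, γ⟩ ∈ G := fun γ => by simp [G]
  have hout : outTrue ∈ G := by simp [G]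
  have hstep := hG₀ G fun γ hγ => by simp [G, hγ]
  obtain ⟨c, hc⟩ := code_stepOrStay_local tm.m G
  choose N hN hloc using hc
  let start (w : List (Bool ⊕ Bool)) : TM2.Cfg tm.Γ tm.Λ tm.σ :=
    initList tm (w.map M.inputAlphabet.symm)
  have hstart : ∀ w, StacksIn G w.length (start w).stk := by
    intro w k
    by_cases hk : k = tm.k₀
    · subst hk
      rw [show (start w).stk tm.k₀ = _ from initList_stk_self tm _]
      exact ⟨by simp, fun γ _ => hG γ⟩
    · rw [show (start w).stk k = _ from initList_stk_of_ne tm _ hk]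
      simp
  have hstart_get : ∀ (w : List (Bool ⊕ Bool)) (i : ℕ),
      ((start w).stk tm.k₀)[i]? = w[i]?.map M.inputAlphabet.symm := by
    intro w i
    rw [show (start w).stk tm.k₀ = _ from initList_stk_self tm _, List.getElem?_map]
  let time (n : ℕ) : ℕ := M.time.eval (n + p.eval n)
  -- Input length plus growth `c₀` per step; the `+ 1` ensures that the place `0` read for
  -- acceptance exists.
  let height (n : ℕ) : ℕ := n + p.eval n + c₀ * time n + 1
  have hrun : ∀ n w, IsPairCode n (p.eval n) w → ∀ t ≤ time n,
      StacksIn G (height n) ((stepOrStay tm.m)^[t] (start w)).stk ∧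
      ∀ q ∉ cells G (Finset.range (height n)),
        code ((stepOrStay tm.m)^[t] (start w)) q = false := by
    rintro n _ ⟨x, y, hx, hy, rfl⟩ t ht
    have h1 := (iterate_stepOrStay_stacksIn hstep (hstart (encodePair (x, y))) t).mono
      (h' := height n) (by
        have : c₀ * t ≤ c₀ * time n := Nat.mul_le_mul_left _ ht
        simp only [encodePair_eq, List.length_append, List.length_map, height]
        omega)
    exact ⟨h1, fun q hq => code_eq_false_of_notMem h1 hq⟩
  have haccept : ∀ n x y, x.length = n → y.length ≤ p.eval n →
      (code ((stepOrStay tm.m)^[time n] (start (encodePair (x, y)))) (.inr (outTrue, 0)) = true ↔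
        R (x, y) = true) := by
    intro n x y hx hy
    have hlen : (encodePair (x, y)).length ≤ n + p.eval n := by
      simp only [encodePair_eq, List.length_append, List.length_map]; omega
    have := iterate_stepOrStay_of_evalsToInTime (M.outputsFun (x, y)) rfl
      (polynomial_eval_mono M.time hlen)
    rw [show (stepOrStay tm.m)^[time n] (start (encodePair (x, y))) = _ from this]
    simp only [code, outTrue, decide_eq_true_eq]
    rw [show TM2.Cfg.stk (haltList M.tm _) tm.k₁ = _ from haltList_stk_self tm _]
    simp [Computability.encodeBool]
  -- The width dominates those of the three conditions: two neighbouring places of the first row, a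
  -- transition, and the accepting bit. The polynomial is the number of rows times the number of
  -- cells per row.
  refine ⟨(Fintype.card (Option tm.Λ × tm.σ) + G.card * 2) + (c + 1) + 1,
    (M.time.comp (.X + p) + 1) * (.C (Fintype.card (Option tm.Λ × tm.σ)) + .C G.card *
      (.X + p + .C c₀ * M.time.comp (.X + p) + 1)), fun n => ?_⟩
  let D : Finset (CodePos tm.Γ tm.Λ tm.σ) := cells G (Finset.range (height n))
  let U := Finset.range (time n + 1) ×ˢ D
  refine ⟨_, U, fun a =>
    (∀ i : ℕ, ∃ w, IsPairCode n (p.eval n) w ∧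
      ∀ q ∈ cells G {i, i + 1}, q ∈ D → a (0, q) = code (start w) q) ∧
    Transitions (stepOrStay tm.m) code (fun X => StacksIn G (height n) X.stk) N D (time n) a ∧
    a (time n, .inr (outTrue, 0)) = true,
    fun i => (0, .inr (⟨tm.k₀, M.inputAlphabet.symm (.inl true)⟩, i)), ?_, ?_, fun i => ?_,
    fun y => ?_⟩
  · simp [U, D, card_cells, time, height]
  · refine .and (.forall fun i => ?_) (.and ((isLocalOn_transitions fun q => hN q).mono ?_) ?_)
    · refine isLocalOn_of_agree (S := ((cells G {i, i + 1}).filter (· ∈ D)).image fun q => (0, q))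
        ?_ ?_ ?_
      · refine Finset.image_subset_iff.2 fun q hq => ?_
        simpa [U] using (Finset.mem_filter.1 hq).2
      · refine Finset.card_image_le.trans ((Finset.card_filter_le _ _).trans ?_)
        rw [card_cells]
        have : ({i, i + 1} : Finset ℕ).card ≤ 2 := Finset.card_le_two
        have := Nat.mul_le_mul_left G.card this
        omega
      · rintro a b hab ⟨w, hw, hb⟩
        refine ⟨w, hw, fun q hq hqD => ?_⟩
        rw [hab _ (Finset.mem_image_of_mem _ (Finset.mem_filter.2 ⟨hq, hqD⟩)), hb q hq hqD]
    · omega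
    · refine isLocalOn_of_agree (S := {(time n, .inr (outTrue, 0))}) ?_ (by simp) ?_
      · simp [U, D, inr_mem_cells, hout, height]
      · intro a b hab hb
        rw [hab _ (by simp), hb]
  · simp only [U, D, Finset.mem_product, inr_mem_cells, hG, Finset.mem_range, height]
    simp; omega
  · have hread : ∀ x z : List Bool, ∀ i (hi : i < x.length),
        code (start (encodePair (x, z)))
          (.inr (⟨tm.k₀, M.inputAlphabet.symm (.inl true)⟩, i)) = x[i] := by
      intro x z i hi
      simp only [code]
      rw [hstart_get, encodePair_eq, List.getElem?_append_left (by simpa using hi)]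
      simp [hi]
    rw [hL]
    constructor
    · rintro ⟨z, hz, hR⟩
      rw [List.length_ofFn] at hz
      have hw : IsPairCode n (p.eval n) (encodePair (List.ofFn y, z)) :=
        ⟨_, _, by simp, hz, rfl⟩
      refine ⟨fun q => code ((stepOrStay tm.m)^[q.1] (start (encodePair (List.ofFn y, z)))) q.2,
        ⟨fun i => ⟨_, hw, fun q _ _ => rfl⟩, transitions_of_run (hrun n _ hw) ?_, ?_⟩, ?_⟩
      · exact fun q X X' hX hX' => hloc q _ _ X X' hX hX'
      · exact (haccept n _ _ (by simp) hz).2 hR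
      · intro i
        exact (hread _ _ i (by simp)).trans (by simp)
    · rintro ⟨a, ⟨hinit, htrans, hacc⟩, hy⟩
      choose w hw hwa using hinit
      -- Windows `i` and `i + 1` share place `i + 1`, so the words witnessing them agree there; this
      -- is what gluing them into one pair code requires.
      have hagree : ∀ i j, (∀ γ ∈ G, .inr (γ, i) ∈ D →
          code (start (w i)) (.inr (γ, i)) = code (start (w j)) (.inr (γ, i))) →
          (w i)[i]? = (w j)[i]? := by
        intro i j h
        have := agreeAt_some_of_code (hrun n _ (hw i) 0 (Nat.zero_le _)).1
          (hrun n _ (hw j) 0 (Nat.zero_le _)).1 (i := i) (fun γ hγ => ?_) tm.k₀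
        · simp only [AgreeAt, Function.iterate_zero, id, hstart_get] at this
          exact Option.map_injective M.inputAlphabet.symm.injective this
        · by_cases hD : .inr (γ, i) ∈ D
          · exact h γ hγ hD
          · rw [(hrun n _ (hw i) 0 (Nat.zero_le _)).2 _ hD,
              (hrun n _ (hw j) 0 (Nat.zero_le _)).2 _ hD]
      obtain ⟨w', hw', hget⟩ := exists_isPairCode w hw fun i => by
        refine (hagree (i + 1) i fun γ hγ hD => ?_).symm
        rw [← hwa i _ (inr_mem_cells.2 ⟨hγ, by simp⟩) hD,
          ← hwa (i + 1) _ (inr_mem_cells.2 ⟨hγ, by simp⟩) hD]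
      have h0 : ∀ q ∈ D, a (0, q) = code (start w') q := by
        rintro (q | ⟨γ, i⟩) hq
        · rw [hwa 0 _ (inl_mem_cells q) hq]
          rfl
        · rw [hwa i _ (inr_mem_cells.2 ⟨(inr_mem_cells.1 hq).1, by simp⟩) hq]
          refine AgreeAt.code_eq ?_
          change ((start (w i)).stk γ.1)[i]? = ((start w').stk γ.1)[i]?
          by_cases hk : γ.1 = tm.k₀
          · rw [hk, hstart_get, hstart_get, hget]
          · rw [show (start w').stk γ.1 = _ from initList_stk_of_ne tm _ hk,
              show (start (w i)).stk γ.1 = _ from initList_stk_of_ne tm _ hk]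
      have hfinal := htrans.eq_run (hrun n _ hw') h0 (time n) le_rfl (.inr (outTrue, 0))
        (inr_mem_cells.2 ⟨hout, by simp [height]⟩)
      obtain ⟨x, z, hx, hz, rfl⟩ := hw'
      have hxy : List.ofFn y = x := by
        refine List.ext_getElem (by simp [hx]) fun i hi hi' => ?_
        rw [← hread x z i hi', ← h0 _ (inr_mem_cells.2 ⟨hG _, by simp [height]; omega⟩)]
        simpa using (hy ⟨i, by omega⟩).symm
      refine ⟨z, by simpa using hz, ?_⟩
      rw [hxy, ← haccept n x z hx hz, ← hfinal, hacc]

/-! ### Adding the constant words -/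

section Local

variable {V W : Type*}

/-- Adding `v` to the set `S` forces the extending assignment to satisfy the premise as well; this
is the extra unit of width. -/
theorem IsLocalOn.imp_of_eq {U : Finset V} {k : ℕ} {P : (V → Bool) → Prop} (h : IsLocalOn U k P)
    {v : V} (hv : v ∈ U) (b : Bool) : IsLocalOn U (k + 1) fun a => a v = b → P a := by
  classical
  intro a ha hav
  refine h a fun S hS hc => ?_
  obtain ⟨a', ha', hagree⟩ := ha (insert v S) (Finset.insert_subset hv hS)
    ((Finset.card_insert_le _ _).trans (Nat.succ_le_succ hc))
  exact ⟨a', ha' (by rw [← hagree v (Finset.mem_insert_self _ _), hav]),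
    fun u hu => hagree u (Finset.mem_insert_of_mem hu)⟩

theorem IsLocalOn.comap {U : Finset V} {U' : Finset W} {k : ℕ} {P : (V → Bool) → Prop}
    (h : IsLocalOn U k P) {f : V → W} (hf : ∀ v ∈ U, f v ∈ U') :
    IsLocalOn U' k fun a => P (a ∘ f) := by
  classical
  intro a ha
  refine h _ fun S hS hc => ?_
  obtain ⟨b, hb, hab⟩ := ha (S.image f) (Finset.image_subset_iff.2 fun v hv => hf v (hS hv))
    (Finset.card_image_le.trans hc)
  exact ⟨_, hb, fun v hv => hab _ (Finset.mem_image_of_mem f hv)⟩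

theorem isLocalOn_eq {U : Finset V} {u v : V} (hu : u ∈ U) (hv : v ∈ U) :
    IsLocalOn U 2 fun a => a u = a v := by
  classical
  refine isLocalOn_of_agree (S := {u, v}) (by simp [Finset.insert_subset_iff, hu, hv])
    Finset.card_le_two fun a b hab hb => ?_
  rw [hab u (by simp), hab v (by simp), hb]

theorem isLocalOn_eq_const {U : Finset V} {u : V} (hu : u ∈ U) (c : Bool) :
    IsLocalOn U 1 fun a => a u = c :=
  isLocalOn_of_agree (S := {u}) (by simpa using hu) (by simp) fun a b hab hb => by
    rw [hab u (by simp), hb]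

end Local

theorem ofFn_mem_true_mul_mul_false {L : Language Bool} {n : ℕ} (y : Fin (n + 2) → Bool) :
    List.ofFn y ∈ ({[true]} : Language Bool) * L * ({[false]} : Language Bool) ↔
      y 0 = true ∧ y (Fin.last n).succ = false ∧
        List.ofFn (fun i : Fin n => y i.castSucc.succ) ∈ L := by
  have hy : List.ofFn y = [y 0] ++ List.ofFn (fun i : Fin n => y i.castSucc.succ) ++
      [y (Fin.last n).succ] := by
    rw [List.ofFn_succ, List.ofFn_succ' fun i => y i.succ]
    simp
  rw [hy]
  constructor
  · rintro ⟨_, ⟨a, ha, w, hw, rfl⟩, b, hb, h⟩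
    change a = [true] at ha
    change b = [false] at hb
    subst ha hb
    simp only [List.cons_append, List.nil_append, List.cons.injEq] at h
    obtain ⟨h1, h2⟩ := List.append_inj' h.2 rfl
    simp only [List.cons.injEq, and_true] at h2
    exact ⟨h.1.symm, h2.symm, h1 ▸ hw⟩
  · rintro ⟨h0, h1, hL⟩
    rw [h0, h1]
    exact Set.mem_image2_of_mem (Set.mem_image2_of_mem rfl hL) rfl

theorem HasLocalVerifier.true_mul_mul_false_add {L : Language Bool} (h : HasLocalVerifier L) :
    HasLocalVerifier (({[true]} : Language Bool) * L * ({[false]} : Language Bool) +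
      ({[false]} : Language Bool)∗ + ({[true]} : Language Bool)∗) := by
  obtain ⟨k, p, h⟩ := h
  refine ⟨k + 3, p + .X + 2, fun n => ?_⟩
  simp only [Language.mem_add, kstar_singleton_ofFn]
  rcases n with _ | _ | n
  · refine ⟨Fin 0, Finset.univ, fun _ => True, id, by simp, fun _ _ => trivial, by simp,
      fun y => ?_⟩
    exact iff_of_true (.inl (.inr fun i => i.elim0)) ⟨y, trivial, fun i => rfl⟩
  -- Both words of length one are constant, so no condition is needed.
  · refine ⟨Fin 1, Finset.univ, fun _ => True, id, by simp, fun _ _ => trivial, by simp,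
      fun y => iff_of_true ?_ ⟨y, trivial, fun i => rfl⟩⟩
    cases h : y 0
    · exact .inl (.inr fun i => by rw [show i = 0 from Fin.fin_one_eq_zero i, h])
    · exact .inr fun i => by rw [show i = 0 from Fin.fin_one_eq_zero i, h]
  obtain ⟨V, U, P, out, hU, hP, hout, hL⟩ := h n
  let U' : Finset (V ⊕ (Fin (n + 2) ⊕ Bool)) := U.disjSum Finset.univ
  let out' (i : Fin (n + 2)) : V ⊕ (Fin (n + 2) ⊕ Bool) := .inr (.inl i)
  -- `sel true` decides whether the word is constant, and `sel false` is then its letter; otherwise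
  -- the word must come from `1 L 0`. This gives `n + 2` output variables and two selectors besides
  -- those of `L` at length `n`.
  let sel (b : Bool) : V ⊕ (Fin (n + 2) ⊕ Bool) := .inr (.inr b)
  have hsel : ∀ b, sel b ∈ U' := by simp [sel, U']
  have hout' : ∀ i, out' i ∈ U' := by simp [out', U']
  have hinl : ∀ v ∈ U, .inl v ∈ U' := by simp [U']
  refine ⟨_, U', fun a => (a (sel true) = true → ∀ i, a (out' i) = a (sel false)) ∧
    (a (sel true) = false → a (out' 0) = true ∧ a (out' (Fin.last n).succ) = false ∧
      (∀ i : Fin n, a (out' i.castSucc.succ) = a (.inl (out i))) ∧ P (a ∘ .inl)),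
    out', ?_, ?_, hout', fun y => ?_⟩
  · have := polynomial_eval_mono p (show n ≤ n + 1 + 1 by omega)
    simp [U'] at this ⊢
    omega
  · refine .and (.imp_of_eq (k := k + 2) ?_ (hsel _) _) (.imp_of_eq (k := k + 2) ?_ (hsel _) _)
    · exact .forall fun i => (isLocalOn_eq (hout' i) (hsel _)).mono (by omega)
    · exact .and ((isLocalOn_eq_const (hout' _) _).mono (by omega)) <|
        .and ((isLocalOn_eq_const (hout' _) _).mono (by omega)) <|
        .and (.forall fun i => (isLocalOn_eq (hout' _) (hinl _ (hout i))).mono (by omega))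
          ((hP.comap hinl).mono (by omega))
  · rw [ofFn_mem_true_mul_mul_false, hL]
    constructor
    · rintro ((⟨h0, h1, a, ha, hay⟩ | hy) | hy)
      · exact ⟨Sum.elim a (Sum.elim y fun _ => false), ⟨by simp [sel], fun _ =>
          ⟨h0, h1, fun i => (hay i).symm, ha⟩⟩, fun i => rfl⟩
      · exact ⟨Sum.elim (fun _ => false) (Sum.elim y id), ⟨fun _ => hy, by simp [sel]⟩,
          fun i => rfl⟩
      · exact ⟨Sum.elim (fun _ => false) (Sum.elim y fun _ => true), ⟨fun _ => hy, by simp [sel]⟩,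
          fun i => rfl⟩
    · rintro ⟨a, ⟨h1, h2⟩, hy⟩
      simp only [hy] at h1 h2
      cases hs : a (sel true)
      · obtain ⟨h0, hl, hm, ha⟩ := h2 hs
        exact .inl (.inl ⟨h0, hl, _, ha, fun i => (hm i).symm⟩)
      · cases hr : a (sel false)
        · exact .inl (.inr fun i => (h1 hs i).trans hr)
        · exact .inr fun i => (h1 hs i).trans hr

/-- Complementation turns `1*` into `0*` and preserves local verifiers, so the `coSAC⁰` construction
applies to `bitwiseNot L` and is then dualized. -/
theorem HasLocalVerifier.hasSAC0ProofSystem {L : Language Bool} (h : HasLocalVerifier L)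
    (h1 : ({[true]} : Language Bool)∗ ≤ L) : HasSAC0ProofSystem L := by
  refine (h.bitwiseNot.hasCoSAC0ProofSystem fun w hw => ?_).dual
  obtain ⟨n, y, rfl⟩ : ∃ (n : ℕ) (y : Fin n → Bool), List.ofFn y = w := ⟨_, w.get, List.ofFn_get w⟩
  have hw := (kstar_singleton_ofFn false y).1 hw
  exact (ofFn_mem_bitwiseNot y).2 (h1 ((kstar_singleton_ofFn _ _).2 fun i => by rw [hw i]; rfl))

end ProofCircuit

theorem theorem10 (L : Language Bool) (hL : ProofCircuit.InNP L) :
    (({[false]} : Language Bool)∗ ≤ L → ProofCircuit.HasCoSAC0ProofSystem L) ∧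
    (({[true]} : Language Bool)∗ ≤ L → ProofCircuit.HasSAC0ProofSystem L) ∧
    (ProofCircuit.HasSAC0ProofSystem
        (({[true]} : Language Bool) * L * ({[false]} : Language Bool) +
          ({[false]} : Language Bool)∗ + ({[true]} : Language Bool)∗) ∧
      ProofCircuit.HasCoSAC0ProofSystem
        (({[true]} : Language Bool) * L * ({[false]} : Language Bool) +
          ({[false]} : Language Bool)∗ + ({[true]} : Language Bool)∗)) :=
  ⟨hL.hasLocalVerifier.hasCoSAC0ProofSystem, hL.hasLocalVerifier.hasSAC0ProofSystem,
    hL.hasLocalVerifier.true_mul_mul_false_add.hasSAC0ProofSystem fun _ hw => .inr hw,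
    hL.hasLocalVerifier.true_mul_mul_false_add.hasCoSAC0ProofSystem fun _ hw => .inl (.inr hw)⟩
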